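/- Let $n,k\in\mathbb N$ and $J_{2m}=\begin{pmatrix}0&I_m\\-I_m&0\end{pmatrix}$. For $A\in\mathbb R^{2n\times 2k}$ write $A^+:=J_{2k}^TA^TJ_{2n}$. Let $\mathrm{SpSt}(2n,2k)=\{U\in\mathbb R^{2n\times 2k}: U^+U=I_{2k}\}$ be the real symplectic Stiefel manifold, let $\mathrm{SpGr}(2n,2k)=\{P\in\mathbb R^{2n\times 2n}: P^2=P,\ \mathrm{rank}(P)=2k,\ P^+=P\}$ be the real symplectic Grassmann manifold, which is a smooth embedded submanifold of $\mathbb R^{2n\times 2n}$, and let $\rho:\mathrm{SpSt}(2n,2k)\to\mathrm{SpGr}(2n,2k)$, $\rho(U)=UU^+$. Let $\mathrm{cay}(X)=(I+X)(I-X)^{-1}$, defined if $I-X$ is invertible, and let $[A,B]=AB-BA$. On $\mathrm{SpSt}(2n,2k)$ consider the pseudo-Riemannian metric $h_U(\Delta_1,\Delta_2)=\mathrm{tr}\big(\Delta_1^+(I_{2n}-\tfrac12UU^+)\Delta_2\big)$ and the map $\mathcal R^{\mathrm{SpSt}}_U(\Delta)=\mathrm{cay}\big(\tfrac12\tilde\Omega(U,\Delta)\big)U$,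 where $\tilde\Omega(U,\Delta)=(I_{2n}-\tfrac12UU^+)\Delta U^+-U\Delta^+(I_{2n}-\tfrac12UU^+)$. For $U\in\mathrm{SpSt}(2n,2k)$ with $\rho(U)=P$ and $\Gamma\in T_P\mathrm{SpGr}(2n,2k)$, the horizontal lift $\Gamma^{\mathsf{hor}}_U$ is the tangent vector $\Delta\in T_U\mathrm{SpSt}(2n,2k)$ that is $h_U$-orthogonal to $\ker d\rho_U$ and satisfies $d\rho_U(\Delta)=\Gamma$. For $P\in\mathrm{SpGr}(2n,2k)$ and $\Gamma\in T_P\mathrm{SpGr}(2n,2k)$ put $$\mathcal R_P(\Gamma):=\mathrm{cay}\big(\tfrac12[\Gamma,P]\big)\,P\,\mathrm{cay}\big(-\tfrac12[\Gamma,P]\big),$$ with domain $\mathcal D$ the set of all $(P,\Gamma)$ in the tangent bundle $T\mathrm{SpGr}(2n,2k)$ for which $I_{2n}-\tfrac12[\Gamma,P]$ is invertible. Then the following hold. 1. $\mathcal R$ is a retraction on $\mathrm{SpGr}(2n,2k)$ with domain $\mathcal D$: the set $\mathcal D$ is open in $T\mathrm{SpGr}(2n,2k)$ and contains the zero section, $\mathcal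 R:\mathcal D\to\mathrm{SpGr}(2n,2k)$ is smooth, and for every $P$ one has $\mathcal R_P(0)=P$ and $d(\mathcal R_P)_0=\mathrm{id}$. 2. Let $P\in\mathrm{SpGr}(2n,2k)$, $\Gamma\in T_P\mathrm{SpGr}(2n,2k)$, and $U\in\mathrm{SpSt}(2n,2k)$ with $UU^+=P$. The horizontal lift $\Gamma^{\mathsf{hor}}_U$ exists, is unique and equals $\Gamma U$. If $(P,\Gamma)\in\mathcal D$, then $\mathcal R^{\mathrm{SpSt}}_U(\Gamma^{\mathsf{hor}}_U)$ is defined and lies in $\mathrm{SpSt}(2n,2k)$, and $\mathcal R_P(\Gamma)=\rho\big(\mathcal R^{\mathrm{SpSt}}_U(\Gamma^{\mathsf{hor}}_U)\big)$. 3. Let $P\in\mathrm{SpGr}(2n,2k)$, $\Gamma\in T_P\mathrm{SpGr}(2n,2k)$ and $\gamma(t)=\mathcal R_P(t\Gamma)$. For every $t\in\mathbb R$ such that $I_{2n}-\tfrac t2[\Gamma,P]$ is invertible, $I_{2n}+\tfrac t2[\Gamma,P]$ is invertible too, and $$\dot\gamma(t)=\Big[\tfrac12[\Gamma,P]\Big(\big(I_{2n}-\tfrac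 t2[\Gamma,P]\big)^{-1}+\big(I_{2n}+\tfrac t2[\Gamma,P]\big)^{-1}\Big),\ \gamma(t)\Big].$$ In particular $\dot\gamma(0)=[[\Gamma,P],P]=\Gamma$. -/

import Mathlib

open scoped ContDiff

/- Real matrices carry the entrywise sup norm; all norms on them are equivalent, so smoothness and
derivatives do not depend on this choice. -/
attribute [local instance] Matrix.normedAddCommGroup Matrix.normedSpace

namespace SymplecticGrassmann

section Submanifolds

variable {E F : Type*} [NormedAddCommGroup E] [NormedSpace ℝ E]
  [NormedAddCommGroup F] [NormedSpace ℝ F]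

/-- `S` is a smooth embedded submanifold of `E`: around each of its points there is a smooth
change of coordinates of `E` which carries `S` to a linear subspace. -/
def IsSmoothSubmanifold (S : Set E) : Prop :=
  ∀ p ∈ S, ∃ (φ : OpenPartialHomeomorph E E) (L : Submodule ℝ E),
    p ∈ φ.source ∧ ContDiffOn ℝ ∞ φ φ.source ∧ ContDiffOn ℝ ∞ φ.symm φ.target ∧
      φ '' (S ∩ φ.source) = φ.target ∩ (L : Set E)

/-- The tangent space of `S` at `p`: all velocities at `p` of smooth curves that run in `S`. -/
def tangentSpaceAt (S : Set E) (p : E) : Set E :=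
  {v | ∃ (ε : ℝ) (γ : ℝ → E), 0 < ε ∧ ContDiffOn ℝ ∞ γ (Set.Ioo (-ε) ε) ∧
    (∀ t ∈ Set.Ioo (-ε) ε, γ t ∈ S) ∧ γ 0 = p ∧ HasDerivAt γ v 0}

/-- The tangent bundle of `S`, as a subset of `E × E`. -/
def tangentBundleSet (S : Set E) : Set (E × E) :=
  {x | x.1 ∈ S ∧ x.2 ∈ tangentSpaceAt S x.1}

/-- A map defined on a subset `A` of a normed space is smooth if near every point of `A` it extends
to a smooth map on an open subset of the ambient space. -/
def IsSmoothOnSubset (f : E → F) (A : Set E) : Prop :=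
  ∀ x ∈ A, ∃ (O : Set E) (g : E → F), IsOpen O ∧ x ∈ O ∧ ContDiffOn ℝ ∞ g O ∧
    Set.EqOn f g (A ∩ O)

/-- `R` is a retraction on the submanifold `S` with domain `D`, where `D` is an open
neighbourhood of the zero section in the tangent bundle of `S`: it is a smooth map `D → S`
such that, for all `p ∈ S`, `R p 0 = p` and the differential of `R p` at `0` is the identity. -/
structure IsRetractionOn (S : Set E) (D : Set (E × E)) (R : E → E → E) : Prop where
  submanifold : IsSmoothSubmanifold S
  domain_open : ∃ O : Set (E × E), IsOpen O ∧ D = tangentBundleSet S ∩ O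
  zero_mem : ∀ p ∈ S, (p, (0 : E)) ∈ D
  maps_to : ∀ x ∈ D, R x.1 x.2 ∈ S
  smooth : IsSmoothOnSubset (fun x : E × E => R x.1 x.2) D
  map_zero : ∀ p ∈ S, R p 0 = p
  differential_zero : ∀ p ∈ S,
    HasFDerivWithinAt (R p) (ContinuousLinearMap.id ℝ E) {v | (p, v) ∈ D} 0

end Submanifolds

/-- Real `2n × 2k` matrices, in `n + n` by `k + k` block form. -/
abbrev Mat (n k : ℕ) : Type := Matrix (Fin n ⊕ Fin n) (Fin k ⊕ Fin k) ℝ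

/-- `J₂ₙ`, the matrix with blocks `0, I; -I, 0`. -/
def stdJ (n : ℕ) : Mat n n := Matrix.fromBlocks 0 1 (-1) 0

/-- The symplectic inverse `A⁺ = J₂ₖᵀ Aᵀ J₂ₙ`. -/
def sinv {n k : ℕ} (A : Mat n k) : Mat k n :=
  (stdJ k).transpose * A.transpose * stdJ n

/-- The real symplectic Stiefel manifold. -/
def SpSt (n k : ℕ) : Set (Mat n k) := {U | sinv U * U = 1}

/-- The real symplectic Grassmann manifold, a set of symplectic projections. -/
def SpGr (n k : ℕ) : Set (Mat n n) := {P | P * P = P ∧ P.rank = 2 * k ∧ sinv P = P}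

/-- The projection `ρ(U) = U U⁺`, written on all matrices. -/
def rho {n k : ℕ} (U : Mat n k) : Mat n n := U * sinv U

/-- The Cayley transform; it is meaningful only if `I - X` is invertible. -/
noncomputable def cay {n : ℕ} (X : Mat n n) : Mat n n := (1 + X) * (1 - X)⁻¹

/-- The matrix `Ω̃(U, Δ) = (I - ½ U U⁺) Δ U⁺ - U Δ⁺ (I - ½ U U⁺)`. -/
noncomputable def tildeOmega {n k : ℕ} (U Δ : Mat n k) : Mat n n :=
  (1 - (1 / 2 : ℝ) • (U * sinv U)) * Δ * sinv U
    - U * sinv Δ * (1 - (1 / 2 : ℝ) • (U * sinv U))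

/-- The Cayley retraction on the symplectic Stiefel manifold. -/
noncomputable def retrSt {n k : ℕ} (U Δ : Mat n k) : Mat n k :=
  cay ((1 / 2 : ℝ) • tildeOmega U Δ) * U

/-- The pseudo-Riemannian metric `h_U(Δ₁, Δ₂) = tr(Δ₁⁺ (I - ½ U U⁺) Δ₂)` on the symplectic
Stiefel manifold. -/
noncomputable def metricSt {n k : ℕ} (U Δ₁ Δ₂ : Mat n k) : ℝ :=
  (sinv Δ₁ * (1 - (1 / 2 : ℝ) • (U * sinv U)) * Δ₂).trace

/-- The vertical space at `U`: the kernel of `dρ_U` on the tangent space at `U`. -/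
def verticalSt {n k : ℕ} (U : Mat n k) : Set (Mat n k) :=
  {Δ | Δ ∈ tangentSpaceAt (SpSt n k) U ∧ fderiv ℝ rho U Δ = 0}

/-- The horizontal space at `U`: the tangent vectors that are orthogonal to the vertical space
with respect to the pseudo-Riemannian metric. -/
def horizontalSt {n k : ℕ} (U : Mat n k) : Set (Mat n k) :=
  {Δ | Δ ∈ tangentSpaceAt (SpSt n k) U ∧ ∀ V ∈ verticalSt U, metricSt U V Δ = 0}

/-- `Δ` is a horizontal lift of `Γ` to `U`. -/
def IsHorizontalLift {n k : ℕ} (U : Mat n k) (Γ : Mat n n) (Δ : Mat n k) : Prop :=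
  Δ ∈ horizontalSt U ∧ fderiv ℝ rho U Δ = Γ

/-- The Cayley retraction `R_P(Γ) = cay(½[Γ,P]) P cay(-½[Γ,P])` on the symplectic Grassmann
manifold. -/
noncomputable def retrGr {n : ℕ} (P Γ : Mat n n) : Mat n n :=
  cay ((1 / 2 : ℝ) • ⁅Γ, P⁆) * P * cay (-((1 / 2 : ℝ) • ⁅Γ, P⁆))

/-- The tangent vectors `(P, Γ)` of the symplectic Grassmann manifold at which the Cayley
transform of `½[Γ,P]` exists. -/
def cayleyDomain (n k : ℕ) : Set (Mat n n × Mat n n) :=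
  {x | x ∈ tangentBundleSet (SpGr n k) ∧ IsUnit (1 - (1 / 2 : ℝ) • ⁅x.2, x.1⁆)}

end SymplecticGrassmann

open SymplecticGrassmann

/-! Differentiating the equations of `SpGr` along curves shows that a tangent vector satisfies Γ⁺ =
Γ and ΓP + PΓ = Γ. Hence PΓP = 0 and [[Γ,P],P] = Γ, while X = ½[Γ,P] satisfies X⁺ = -X. So cay(X) is
symplectic with inverse cay(-X), and conjugation by it preserves `SpGr` (`conj_cay_mem_SpGr_iff`).
Differentiating this conjugation (`hasDerivAt_conj_cay_smul`) gives a commutator, equal to [[Γ,P],P]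
= Γ at t = 0.

The submanifold property uses the same conjugation: a matrix A is split into its tangent part τ at P
and the rest ν, and P + ν is conjugated by cay(½[τ,P]). This map has identity differential at 0, and
its value lies in `SpGr` exactly when ν = 0 (`eq_zero_of_add_mem_SpGr`).

On the Stiefel side the vertical vectors are UB with B⁺ = -B, and ΓU is orthogonal to them because
U⁺ΓU = 0. Uniqueness is nondegeneracy of the metric on vertical vectors (`isHorizontalLift_iff`).
Finally Ω̃(U, ΓU) = [Γ,P] (`tildeOmega_mul`), so both retractions use the same Cayley factor. -/

namespace SymplecticGrassmann

/-! ### Calculus of matrix products and inverses. -/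

section MatrixCalculus

variable {l m o : Type*}
  {E : Type*} [NormedAddCommGroup E] [NormedSpace ℝ E]

theorem hasDerivAt_matrix_iff [Fintype m] {f : ℝ → Matrix l m ℝ} {f' : Matrix l m ℝ} {t : ℝ} :
    HasDerivAt f f' t ↔ ∀ i j, HasDerivAt (fun s => f s i j) (f' i j) t :=
  hasDerivAt_pi.trans (forall_congr' fun _ => hasDerivAt_pi)

theorem hasDerivAt_matrix_mul [Fintype m] [Fintype o] {f : ℝ → Matrix l m ℝ}
    {g : ℝ → Matrix m o ℝ}
    {f' : Matrix l m ℝ} {g' : Matrix m o ℝ} {t : ℝ}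
    (hf : HasDerivAt f f' t) (hg : HasDerivAt g g' t) :
    HasDerivAt (fun s => f s * g s) (f' * g t + f t * g') t := by
  rw [hasDerivAt_matrix_iff] at *
  intro i j
  simp only [Matrix.mul_apply, Matrix.add_apply, ← Finset.sum_add_distrib]
  exact HasDerivAt.fun_sum fun a _ => (hf i a).mul (hg a j)

theorem hasDerivAt_matrix_mul_const [Fintype m] [Fintype o] {f : ℝ → Matrix l m ℝ}
    {f' : Matrix l m ℝ} {t : ℝ}
    (hf : HasDerivAt f f' t) (B : Matrix m o ℝ) : HasDerivAt (fun s => f s * B) (f' * B) t := by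
  simpa using hasDerivAt_matrix_mul hf (hasDerivAt_const t B)

variable [Fintype l] [Fintype m] [Fintype o]

theorem contDiffAt_matrix_iff {r : WithTop ℕ∞} {f : E → Matrix l m ℝ} {x : E} :
    ContDiffAt ℝ r f x ↔ ∀ i j, ContDiffAt ℝ r (fun y => f y i j) x :=
  contDiffAt_pi.trans (forall_congr' fun _ => contDiffAt_pi)

theorem contDiffAt_matrix_mul {r : WithTop ℕ∞} {f : E → Matrix l m ℝ} {g : E → Matrix m o ℝ}
    {x : E} (hf : ContDiffAt ℝ r f x) (hg : ContDiffAt ℝ r g x) :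
    ContDiffAt ℝ r (fun y => f y * g y) x := by
  rw [contDiffAt_matrix_iff] at *
  intro i j
  simp only [Matrix.mul_apply]
  exact ContDiffAt.sum fun a _ => (hf i a).mul (hg a j)

theorem contDiffAt_matrix_transpose {r : WithTop ℕ∞} {f : E → Matrix l m ℝ} {x : E}
    (hf : ContDiffAt ℝ r f x) : ContDiffAt ℝ r (fun y => (f y).transpose) x := by
  rw [contDiffAt_matrix_iff] at *
  exact fun i j => hf j i

theorem hasDerivAt_matrix_transpose {f : ℝ → Matrix l m ℝ} {f' : Matrix l m ℝ} {t : ℝ}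
    (hf : HasDerivAt f f' t) : HasDerivAt (fun s => (f s).transpose) f'.transpose t := by
  rw [hasDerivAt_matrix_iff] at *
  exact fun i j => hf j i

theorem hasDerivAt_const_matrix_mul {f : ℝ → Matrix m o ℝ} {f' : Matrix m o ℝ} {t : ℝ}
    (A : Matrix l m ℝ) (hf : HasDerivAt f f' t) : HasDerivAt (fun s => A * f s) (A * f') t := by
  simpa using hasDerivAt_matrix_mul (hasDerivAt_const t A) hf

variable [DecidableEq m]

theorem contDiffAt_matrix_det {r : WithTop ℕ∞} {f : E → Matrix m m ℝ} {x : E}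
    (hf : ContDiffAt ℝ r f x) : ContDiffAt ℝ r (fun y => (f y).det) x := by
  rw [contDiffAt_matrix_iff] at hf
  simp only [Matrix.det_apply]
  exact ContDiffAt.sum fun σ _ => (contDiffAt_prod fun i _ => hf (σ i) i).const_smul _

/-- Cramer's rule: the entries of the adjugate are determinants, hence polynomial in the entries of
the matrix. -/
theorem contDiffAt_matrix_inv {r : WithTop ℕ∞} {f : E → Matrix m m ℝ} {x : E}
    (hf : ContDiffAt ℝ r f x) (hx : IsUnit (f x)) :
    ContDiffAt ℝ r (fun y => (f y)⁻¹) x := by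
  have hdet : (f x).det ≠ 0 := ((Matrix.isUnit_iff_isUnit_det _).1 hx).ne_zero
  have hadj : ContDiffAt ℝ r (fun y => (f y).adjugate) x := by
    rw [contDiffAt_matrix_iff] at *
    intro i j
    simp only [Matrix.adjugate_apply]
    refine contDiffAt_matrix_det (contDiffAt_matrix_iff.2 fun a b => ?_)
    simp only [Matrix.updateRow_apply]
    split_ifs
    · exact contDiffAt_const
    · exact hf a b
  simp only [Matrix.inv_def, Ring.inverse_eq_inv']
  exact ((contDiffAt_matrix_det hf).inv hdet).smul hadj

theorem isOpen_setOf_isUnit_matrix : IsOpen {A : Matrix m m ℝ | IsUnit A} := by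
  have h : {A : Matrix m m ℝ | IsUnit A} = Matrix.det ⁻¹' {0}ᶜ := by
    ext A
    simp [Matrix.isUnit_iff_isUnit_det]
  rw [h]
  refine IsOpen.preimage ?_ isOpen_compl_singleton
  exact Continuous.matrix_det continuous_id

theorem hasDerivAt_matrix_inv {f : ℝ → Matrix m m ℝ} {f' : Matrix m m ℝ} {t : ℝ}
    (hf : HasDerivAt f f' t) (ht : IsUnit (f t)) :
    HasDerivAt (fun s => (f s)⁻¹) (-((f t)⁻¹ * f' * (f t)⁻¹)) t := by
  have hd : DifferentiableAt ℝ (fun A : Matrix m m ℝ => A⁻¹) (f t) :=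
    (contDiffAt_matrix_inv (r := 1) contDiffAt_id ht).differentiableAt one_ne_zero
  obtain ⟨g', hg⟩ : ∃ g', HasDerivAt (fun s => (f s)⁻¹) g' t :=
    ⟨_, (hd.hasFDerivAt.comp_hasDerivAt t hf)⟩
  -- Once a derivative is known to exist, differentiating f f⁻¹ = 1 determines it.
  have hev : ∀ᶠ s in nhds t, f s * (f s)⁻¹ = 1 := by
    filter_upwards [hf.continuousAt.eventually (isOpen_setOf_isUnit_matrix.mem_nhds ht)] with s hs
    exact Matrix.mul_nonsing_inv _ ((Matrix.isUnit_iff_isUnit_det _).1 hs)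
  have h0 := ((hasDerivAt_const t (1 : Matrix m m ℝ)).congr_of_eventuallyEq hev).unique
    (hasDerivAt_matrix_mul hf hg)
  have hinv : (f t)⁻¹ * f t = 1 := Matrix.nonsing_inv_mul _ ((Matrix.isUnit_iff_isUnit_det _).1 ht)
  have : g' = -((f t)⁻¹ * f' * (f t)⁻¹) := by
    have h1 := congrArg ((f t)⁻¹ * ·) h0
    simp only [mul_zero, mul_add, ← mul_assoc, hinv, one_mul] at h1
    exact eq_neg_of_add_eq_zero_right h1.symm
  exact this ▸ hg

end MatrixCalculus

/-! ### Algebra of the symplectic inverse. -/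

section SymplecticInverse

variable {n k l : ℕ}

theorem stdJ_transpose_mul_stdJ (n : ℕ) : (stdJ n).transpose * stdJ n = 1 := by
  simp [stdJ, Matrix.fromBlocks_transpose, Matrix.fromBlocks_multiply]

theorem stdJ_mul_stdJ_transpose (n : ℕ) : stdJ n * (stdJ n).transpose = 1 := by
  simp [stdJ, Matrix.fromBlocks_transpose, Matrix.fromBlocks_multiply]

theorem stdJ_transpose (n : ℕ) : (stdJ n).transpose = -stdJ n := by
  simp [stdJ, Matrix.fromBlocks_transpose, Matrix.fromBlocks_neg]

theorem sinv_mul (A : Mat n k) (B : Mat k l) : sinv (A * B) = sinv B * sinv A := by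
  have h : sinv B * sinv A = (stdJ l).transpose * B.transpose *
      (stdJ k * (stdJ k).transpose) * A.transpose * stdJ n := by
    simp only [sinv, Matrix.mul_assoc]
  rw [h, stdJ_mul_stdJ_transpose, Matrix.mul_one, sinv, Matrix.transpose_mul]
  simp only [Matrix.mul_assoc]

theorem sinv_add (A B : Mat n k) : sinv (A + B) = sinv A + sinv B := by
  simp [sinv, Matrix.mul_add, Matrix.add_mul]

theorem sinv_smul (c : ℝ) (A : Mat n k) : sinv (c • A) = c • sinv A := by
  simp [sinv]

theorem sinv_sub (A B : Mat n k) : sinv (A - B) = sinv A - sinv B := by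
  simp [sinv, Matrix.mul_sub, Matrix.sub_mul]

theorem sinv_one : sinv (1 : Mat n n) = 1 := by
  simp [sinv, stdJ_transpose_mul_stdJ]

theorem sinv_sinv (A : Mat n k) : sinv (sinv A) = A := by
  have h : sinv (sinv A) = (stdJ n).transpose * (stdJ n).transpose * A *
      (stdJ k * stdJ k) := by
    simp only [sinv, Matrix.transpose_mul, Matrix.transpose_transpose, Matrix.mul_assoc]
  have h1 : stdJ k * stdJ k = -1 := by
    have := stdJ_transpose_mul_stdJ k
    rw [stdJ_transpose, neg_mul] at this
    rw [← this, neg_neg]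
  have h2 : (stdJ n).transpose * (stdJ n).transpose = -1 := by
    have := stdJ_transpose_mul_stdJ n
    rw [← this, stdJ_transpose, mul_neg]
  rw [h, h1, h2]
  simp

theorem sinv_transpose (A : Mat n k) : sinv A.transpose = (sinv A).transpose := by
  simp [sinv, Matrix.transpose_mul, stdJ_transpose, Matrix.mul_assoc]

theorem sinv_lie (A B : Mat n n) : sinv ⁅A, B⁆ = ⁅sinv B, sinv A⁆ := by
  rw [Ring.lie_def, Ring.lie_def, sinv_sub, sinv_mul, sinv_mul]

theorem sinv_inv {A : Mat n n} (hA : IsUnit A) : sinv A⁻¹ = (sinv A)⁻¹ := by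
  symm
  apply Matrix.inv_eq_right_inv
  rw [← sinv_mul, Matrix.nonsing_inv_mul _ ((Matrix.isUnit_iff_isUnit_det _).1 hA), sinv_one]

theorem isUnit_sinv {A : Mat n n} (hA : IsUnit A) : IsUnit (sinv A) := by
  refine IsUnit.of_mul_eq_one (sinv A⁻¹) ?_
  rw [← sinv_mul, Matrix.nonsing_inv_mul _ ((Matrix.isUnit_iff_isUnit_det _).1 hA), sinv_one]

variable {E : Type*} [NormedAddCommGroup E] [NormedSpace ℝ E]

theorem contDiffAt_sinv {r : WithTop ℕ∞} {f : E → Mat n k} {x : E} (hf : ContDiffAt ℝ r f x) :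
    ContDiffAt ℝ r (fun y => sinv (f y)) x :=
  contDiffAt_matrix_mul (contDiffAt_matrix_mul contDiffAt_const (contDiffAt_matrix_transpose hf))
    contDiffAt_const

theorem hasDerivAt_sinv {f : ℝ → Mat n k} {f' : Mat n k} {t : ℝ} (hf : HasDerivAt f f' t) :
    HasDerivAt (fun s => sinv (f s)) (sinv f') t :=
  hasDerivAt_matrix_mul_const (hasDerivAt_const_matrix_mul _ (hasDerivAt_matrix_transpose hf)) _

end SymplecticInverse

/-! ### The Cayley transform and its derivative. -/

section Cayley

variable {n : ℕ}

/-- For such X, the symplectic inverse of 1 - X is 1 + X. -/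
theorem isUnit_one_add {X : Mat n n} (hX : sinv X = -X) (h : IsUnit (1 - X)) : IsUnit (1 + X) := by
  simpa [sinv_sub, sinv_one, hX] using isUnit_sinv h

theorem commute_one_add_inv (X : Mat n n) : Commute (1 + X) (1 - X)⁻¹ := by
  by_cases h : IsUnit (1 - X)
  · have h1 := Matrix.nonsing_inv_mul _ ((Matrix.isUnit_iff_isUnit_det _).1 h)
    have h2 := Matrix.mul_nonsing_inv _ ((Matrix.isUnit_iff_isUnit_det _).1 h)
    have h3 : (1 - X) * (1 + X) = (1 + X) * (1 - X) := by noncomm_ring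
    calc (1 + X) * (1 - X)⁻¹ = (1 - X)⁻¹ * ((1 - X) * (1 + X)) * (1 - X)⁻¹ := by
          rw [← mul_assoc, h1, one_mul]
      _ = (1 - X)⁻¹ * (1 + X) * ((1 - X) * (1 - X)⁻¹) := by rw [h3]; simp only [mul_assoc]
      _ = (1 - X)⁻¹ * (1 + X) := by rw [h2, mul_one]
  -- The inverse of a singular matrix is 0 by convention, and 0 commutes with everything.
  · rw [Matrix.nonsing_inv_apply_not_isUnit _ fun hd => h ((Matrix.isUnit_iff_isUnit_det _).2 hd)]
    exact Commute.zero_right _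

theorem cay_mul_cay_neg {X : Mat n n} (h : IsUnit (1 - X)) (h' : IsUnit (1 + X)) :
    cay X * cay (-X) = 1 := by
  have h1 := Matrix.nonsing_inv_mul _ ((Matrix.isUnit_iff_isUnit_det _).1 h)
  have h2 := Matrix.mul_nonsing_inv _ ((Matrix.isUnit_iff_isUnit_det _).1 h')
  calc cay X * cay (-X) = (1 + X) * ((1 - X)⁻¹ * (1 - X)) * (1 + X)⁻¹ := by
        simp only [cay, sub_neg_eq_add, ← sub_eq_add_neg, mul_assoc]
    _ = 1 := by rw [h1, mul_one, h2]

theorem cay_neg_mul_cay {X : Mat n n} (h : IsUnit (1 - X)) (h' : IsUnit (1 + X)) :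
    cay (-X) * cay X = 1 := by
  simpa using cay_mul_cay_neg (X := -X) (by simpa using h') (by simpa [← sub_eq_add_neg] using h)

theorem cay_zero : cay (0 : Mat n n) = 1 := by
  simp [cay]

theorem sinv_cay {X : Mat n n} (hX : sinv X = -X) (h : IsUnit (1 - X)) :
    sinv (cay X) = cay (-X) := by
  rw [cay, sinv_mul, sinv_inv h, sinv_sub, sinv_add, sinv_one, hX, cay]
  exact (commute_one_add_inv (-X)).eq.symm

variable {E : Type*} [NormedAddCommGroup E] [NormedSpace ℝ E]

theorem contDiffAt_cay {r : WithTop ℕ∞} {f : E → Mat n n} {x : E} (hf : ContDiffAt ℝ r f x)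
    (hx : IsUnit (1 - f x)) : ContDiffAt ℝ r (fun y => cay (f y)) x :=
  contDiffAt_matrix_mul (contDiffAt_const.add hf)
    (contDiffAt_matrix_inv (contDiffAt_const.sub hf) hx)

/-- The product rule gives X(1 - tX)⁻¹ + (1 + tX)(1 - tX)⁻¹X(1 - tX)⁻¹. Invertibility of 1 + tX
allows cay(tX) to be split off on the right, the form that later produces a commutator. -/
theorem hasDerivAt_cay_smul {X : Mat n n} {t : ℝ} (h : IsUnit (1 - t • X))
    (h' : IsUnit (1 + t • X)) :
    HasDerivAt (fun s : ℝ => cay (s • X))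
      (X * ((1 - t • X)⁻¹ + (1 + t • X)⁻¹) * cay (t • X)) t := by
  have hs : HasDerivAt (fun s : ℝ => s • X) X t := by
    have h0 := (hasDerivAt_id t).smul_const X
    rw [one_smul] at h0
    exact h0
  have key := hasDerivAt_matrix_mul (hs.const_add 1) (hasDerivAt_matrix_inv (hs.const_sub 1) h)
  refine key.congr_deriv ?_
  have h1 := Matrix.nonsing_inv_mul _ ((Matrix.isUnit_iff_isUnit_det _).1 h')
  have hc := commute_one_add_inv (t • X)
  have hX : Commute X (1 - t • X)⁻¹ := by
    have h2 := Matrix.nonsing_inv_mul _ ((Matrix.isUnit_iff_isUnit_det _).1 h)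
    have h3 := Matrix.mul_nonsing_inv _ ((Matrix.isUnit_iff_isUnit_det _).1 h)
    have h4 : (1 - t • X) * X = X * (1 - t • X) := by simp [mul_sub, sub_mul]
    calc X * (1 - t • X)⁻¹ = (1 - t • X)⁻¹ * ((1 - t • X) * X) * (1 - t • X)⁻¹ := by
          rw [← mul_assoc, h2, one_mul]
      _ = (1 - t • X)⁻¹ * X * ((1 - t • X) * (1 - t • X)⁻¹) := by rw [h4]; simp only [mul_assoc]
      _ = _ := by rw [h3, mul_one]
  have hX' : X * (1 + t • X) = (1 + t • X) * X := by simp [mul_add, add_mul]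
  rw [cay, mul_add X, add_mul (X * _), mul_neg _ X, neg_mul (_ * X), neg_neg, add_comm]
  congr 1
  · calc (1 + t • X) * ((1 - t • X)⁻¹ * X * (1 - t • X)⁻¹)
        = (1 + t • X) * (X * (1 - t • X)⁻¹ * (1 - t • X)⁻¹) := by rw [hX.eq]
      _ = X * ((1 + t • X) * (1 - t • X)⁻¹) * (1 - t • X)⁻¹ := by
          simp only [← mul_assoc]; rw [hX']
      _ = X * ((1 - t • X)⁻¹ * (1 + t • X)) * (1 - t • X)⁻¹ := by rw [hc.eq]
      _ = _ := by simp only [mul_assoc]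
  · calc X * (1 - t • X)⁻¹ = X * ((1 + t • X)⁻¹ * (1 + t • X)) * (1 - t • X)⁻¹ := by
          rw [h1, mul_one]
      _ = _ := by simp only [mul_assoc]

end Cayley

/-! ### Charts from the inverse function theorem. -/

section Chart

variable {E : Type*} [NormedAddCommGroup E] [NormedSpace ℝ E] [CompleteSpace E]

theorem exists_chart_of_local_parametrization {S : Set E} {p : E} {L : Submodule ℝ E}
    {ψ : E → E} {O : Set E} (hO : IsOpen O) (h0 : (0 : E) ∈ O) (hψ : ContDiffOn ℝ ∞ ψ O)
    (hd : HasFDerivAt ψ (ContinuousLinearMap.id ℝ E) 0) (hp : ψ 0 = p)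
    (hS : ∀ x ∈ O, ψ x ∈ S ↔ x ∈ L) :
    ∃ (φ : OpenPartialHomeomorph E E) (L : Submodule ℝ E),
      p ∈ φ.source ∧ ContDiffOn ℝ ∞ φ φ.source ∧ ContDiffOn ℝ ∞ φ.symm φ.target ∧
        φ '' (S ∩ φ.source) = φ.target ∩ (L : Set E) := by
  have hat : ContDiffAt ℝ ∞ ψ 0 := hψ.contDiffAt (hO.mem_nhds h0)
  have hd' : HasFDerivAt ψ ((ContinuousLinearEquiv.refl ℝ E : E ≃L[ℝ] E) : E →L[ℝ] E) 0 := hd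
  set e := hat.toOpenPartialHomeomorph ψ hd' (by simp) with he
  have hcont : ContinuousOn (fderiv ℝ ψ) O :=
    (hψ.fderiv_of_isOpen (m := ∞) hO (by simp)).continuousOn
  -- The local inverse is smooth where the differential of ψ is invertible; restricting to this open
  -- set makes the chart smooth on its whole source.
  set W : Set E := O ∩ fderiv ℝ ψ ⁻¹' Set.range ((↑) : (E ≃L[ℝ] E) → E →L[ℝ] E) with hW
  have hWo : IsOpen W := hcont.isOpen_inter_preimage hO ContinuousLinearEquiv.isOpen
  have h0W : (0 : E) ∈ W := ⟨h0, ContinuousLinearEquiv.refl ℝ E, hd'.fderiv.symm⟩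
  have h0e : (0 : E) ∈ e.source := hat.mem_toOpenPartialHomeomorph_source hd' (by simp)
  set e' := e.restrOpen W hWo with he'
  have hcoe : ∀ x, e' x = ψ x := fun x => rfl
  have hsrc : e'.source = e.source ∩ W := rfl
  have h0' : (0 : E) ∈ e'.source := ⟨h0e, h0W⟩
  refine ⟨e'.symm, L, ?_, ?_, ?_, ?_⟩
  · rw [← hp]
    exact e'.map_source h0'
  · intro y hy
    have hx : e'.symm y ∈ e'.source := e'.map_target hy
    obtain ⟨f', hf'⟩ := hx.2.2
    refine (e'.contDiffAt_symm (f₀' := f') hy ?_ ?_).contDiffWithinAt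
    · rw [hf']
      exact ((hψ.contDiffAt (hO.mem_nhds hx.2.1)).differentiableAt (by simp)).hasFDerivAt
    · exact hψ.contDiffAt (hO.mem_nhds hx.2.1)
  · exact fun x hx => (hψ.contDiffAt (hO.mem_nhds hx.2.1)).contDiffWithinAt
  · ext x
    constructor
    · rintro ⟨y, ⟨hyS, hy⟩, rfl⟩
      have hx : e'.symm y ∈ e'.source := e'.map_target hy
      refine ⟨hx, (hS _ hx.2.1).1 ?_⟩
      rw [← hcoe, e'.right_inv hy]
      exact hyS
    · rintro ⟨hx, hxL⟩
      exact ⟨ψ x, ⟨(hS x hx.2.1).2 hxL, e'.map_source hx⟩, e'.left_inv hx⟩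

end Chart

/-! ### Tangent vectors and Cayley conjugation on the symplectic Grassmannian. -/

section Grassmannian

variable {n k : ℕ}

theorem lie_lie_eq {P Γ : Mat n n} (hP : P * P = P) :
    ⁅⁅Γ, P⁆, P⁆ = Γ * P - (2 : ℝ) • (P * Γ * P) + P * Γ := by
  simp only [Ring.lie_def, sub_mul, mul_sub, ← mul_assoc, hP, two_smul]
  rw [mul_assoc Γ P P, hP]
  abel

theorem mul_mul_eq_zero_of_tangent {P Γ : Mat n n} (hP : P * P = P) (hΓ : Γ * P + P * Γ = Γ) :
    P * Γ * P = 0 := by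
  have h1 := congrArg (P * ·) hΓ
  simp only [mul_add, ← mul_assoc, hP] at h1
  exact left_eq_add.1 (by rw [add_comm]; exact h1.symm)

theorem lie_lie_eq_self {P Γ : Mat n n} (hP : P * P = P) (hΓ : Γ * P + P * Γ = Γ) :
    ⁅⁅Γ, P⁆, P⁆ = Γ := by
  rw [lie_lie_eq hP, mul_mul_eq_zero_of_tangent hP hΓ, smul_zero, sub_zero, hΓ]

/-- In the splitting given by P, the double commutator keeps exactly the two off-diagonal blocks
PX(1 - P) and (1 - P)XP of X. -/
theorem lie_lie_idem {P X : Mat n n} (hP : P * P = P) :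
    ⁅⁅X, P⁆, P⁆ * P + P * ⁅⁅X, P⁆, P⁆ = ⁅⁅X, P⁆, P⁆ := by
  have h : ∀ Y : Mat n n, Y * P * P = Y * P := fun Y => by rw [mul_assoc, hP]
  rw [lie_lie_eq hP]
  simp only [sub_mul, mul_sub, add_mul, mul_add, ← mul_assoc, hP, two_smul, h]
  abel

theorem sinv_eq_of_mem_tangentSpaceAt {P Γ : Mat n n} (hΓ : Γ ∈ tangentSpaceAt (SpGr n k) P) :
    sinv Γ = Γ := by
  obtain ⟨ε, γ, hε, -, hγ, -, hd⟩ := hΓ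
  have hev : ∀ᶠ t in nhds (0 : ℝ), sinv (γ t) = γ t := by
    filter_upwards [Ioo_mem_nhds (neg_lt_zero.2 hε) hε] with t ht
    exact (hγ t ht).2.2
  exact ((hasDerivAt_sinv hd).congr_of_eventuallyEq (Filter.EventuallyEq.symm hev)).unique hd

theorem mul_add_mul_eq_of_mem_tangentSpaceAt {P Γ : Mat n n}
    (hΓ : Γ ∈ tangentSpaceAt (SpGr n k) P) : Γ * P + P * Γ = Γ := by
  obtain ⟨ε, γ, hε, -, hγ, h0, hd⟩ := hΓ
  have hev : ∀ᶠ t in nhds (0 : ℝ), γ t * γ t = γ t := by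
    filter_upwards [Ioo_mem_nhds (neg_lt_zero.2 hε) hε] with t ht
    exact (hγ t ht).1
  rw [← h0]
  exact ((hasDerivAt_matrix_mul hd hd).congr_of_eventuallyEq
    (Filter.EventuallyEq.symm hev)).unique hd

theorem sinv_half_lie {P Γ : Mat n n} (hP : sinv P = P) (hΓ : sinv Γ = Γ) :
    sinv ((1 / 2 : ℝ) • ⁅Γ, P⁆) = -((1 / 2 : ℝ) • ⁅Γ, P⁆) := by
  rw [sinv_smul, sinv_lie, hP, hΓ, ← smul_neg, Ring.lie_def, Ring.lie_def, neg_sub]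

/-- Conjugation by the Cayley transform of an infinitesimally symplectic matrix. -/
theorem conj_cay_mem_SpGr_iff {X Q : Mat n n} (hX : sinv X = -X) (h : IsUnit (1 - X)) :
    cay X * Q * cay (-X) ∈ SpGr n k ↔ Q ∈ SpGr n k := by
  have h1 := cay_mul_cay_neg h (isUnit_one_add hX h)
  have h2 := cay_neg_mul_cay h (isUnit_one_add hX h)
  -- Both directions are instances of this, with cay(X) and cay(-X) exchanged.
  have key : ∀ (C D : Mat n n), C * D = 1 → D * C = 1 → sinv C = D → ∀ Q, Q ∈ SpGr n k →
      C * Q * D ∈ SpGr n k := by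
    rintro C D hCD hDC hs Q ⟨hQ1, hQ2, hQ3⟩
    have hC : IsUnit C.det := (Matrix.isUnit_iff_isUnit_det _).1 (IsUnit.of_mul_eq_one _ hCD)
    have hD : IsUnit D.det := (Matrix.isUnit_iff_isUnit_det _).1 (IsUnit.of_mul_eq_one _ hDC)
    refine ⟨?_, ?_, ?_⟩
    · calc C * Q * D * (C * Q * D) = C * Q * (D * C) * Q * D := by simp only [mul_assoc]
        _ = C * (Q * Q) * D := by rw [hDC, mul_one, mul_assoc C]
        _ = _ := by rw [hQ1]
    · rw [Matrix.rank_mul_eq_left_of_isUnit_det _ _ hD,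
        Matrix.rank_mul_eq_right_of_isUnit_det _ _ hC, hQ2]
    · rw [sinv_mul, sinv_mul, hQ3, hs, ← hs, sinv_sinv, mul_assoc]
  have hs := sinv_cay hX h
  constructor
  · intro hQ
    have := key _ _ h2 h1 (by rw [← hs, sinv_sinv]) _ hQ
    have e : cay (-X) * (cay X * Q * cay (-X)) * cay X
        = (cay (-X) * cay X) * Q * (cay (-X) * cay X) := by simp only [mul_assoc]
    rwa [e, h2, one_mul, mul_one] at this
  · exact key _ _ h1 h2 hs Q

theorem retrGr_mem_SpGr {P Γ : Mat n n} (hP : P ∈ SpGr n k) (hΓ : sinv Γ = Γ)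
    (h : IsUnit (1 - (1 / 2 : ℝ) • ⁅Γ, P⁆)) : retrGr P Γ ∈ SpGr n k :=
  (conj_cay_mem_SpGr_iff (sinv_half_lie hP.2.2 hΓ) h).2 hP

theorem retrGr_zero (P : Mat n n) : retrGr P 0 = P := by
  simp [retrGr, Ring.lie_def, cay_zero]

variable {E : Type*} [NormedAddCommGroup E] [NormedSpace ℝ E]

theorem contDiffAt_lie {r : WithTop ℕ∞} {f g : E → Mat n n} {x : E} (hf : ContDiffAt ℝ r f x)
    (hg : ContDiffAt ℝ r g x) : ContDiffAt ℝ r (fun y => ⁅f y, g y⁆) x := by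
  simp only [Ring.lie_def]
  exact (contDiffAt_matrix_mul hf hg).sub (contDiffAt_matrix_mul hg hf)

theorem contDiffAt_conj_cay {r : WithTop ℕ∞} {f g : E → Mat n n} {x : E}
    (hf : ContDiffAt ℝ r f x) (hg : ContDiffAt ℝ r g x) (hx : IsUnit (1 - f x))
    (hx' : IsUnit (1 + f x)) :
    ContDiffAt ℝ r (fun y => cay (f y) * g y * cay (-f y)) x :=
  contDiffAt_matrix_mul (contDiffAt_matrix_mul (contDiffAt_cay hf hx) hg)
    (contDiffAt_cay hf.neg (by simpa using hx'))

/-- The middle factor may vary so that the formula serves both the retraction curve (g constant) and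
the differential of the chart. -/
theorem hasDerivAt_conj_cay_smul {X : Mat n n} {t : ℝ} {g : ℝ → Mat n n} {g' : Mat n n}
    (hg : HasDerivAt g g' t) (h : IsUnit (1 - t • X)) (h' : IsUnit (1 + t • X)) :
    HasDerivAt (fun s : ℝ => cay (s • X) * g s * cay (-(s • X)))
      (⁅X * ((1 - t • X)⁻¹ + (1 + t • X)⁻¹), cay (t • X) * g t * cay (-(t • X))⁆ +
        cay (t • X) * g' * cay (-(t • X))) t := by
  have h1 := hasDerivAt_cay_smul h h'
  -- Differentiated as the inverse of cay(sX), so that Y appears to the right of cay(-tX), as the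
  -- commutator needs.
  have h2 : HasDerivAt (fun s : ℝ => cay (-(s • X)))
      (-(cay (-(t • X)) * (X * ((1 - t • X)⁻¹ + (1 + t • X)⁻¹)))) t := by
    set Y := X * ((1 - t • X)⁻¹ + (1 + t • X)⁻¹) with hY
    have hu : IsUnit (cay (t • X)) := IsUnit.of_mul_eq_one _ (cay_mul_cay_neg h h')
    have hinv : (cay (t • X))⁻¹ = cay (-(t • X)) :=
      Matrix.inv_eq_right_inv (cay_mul_cay_neg h h')
    have h3 := hasDerivAt_matrix_inv h1 hu
    rw [hinv] at h3
    have ho : IsOpen {s : ℝ | IsUnit (1 - s • X) ∧ IsUnit (1 + s • X)} :=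
      (isOpen_setOf_isUnit_matrix.preimage (by fun_prop : Continuous fun s : ℝ => 1 - s • X)).inter
        (isOpen_setOf_isUnit_matrix.preimage (by fun_prop : Continuous fun s : ℝ => 1 + s • X))
    have hev : (fun s : ℝ => cay (-(s • X))) =ᶠ[nhds t] fun s => (cay (s • X))⁻¹ := by
      filter_upwards [ho.mem_nhds ⟨h, h'⟩] with s hs
      exact (Matrix.inv_eq_right_inv (cay_mul_cay_neg hs.1 hs.2)).symm
    refine (h3.congr_of_eventuallyEq hev).congr_deriv ?_
    rw [← mul_assoc (cay (-(t • X))) Y, mul_assoc _ (cay (t • X)), cay_mul_cay_neg h h', mul_one]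
  refine (hasDerivAt_matrix_mul (hasDerivAt_matrix_mul h1 hg) h2).congr_deriv ?_
  simp only [Ring.lie_def, add_mul, mul_neg, mul_assoc]
  abel

theorem hasDerivAt_retrGr_smul {P Γ : Mat n n} {t : ℝ} (h : IsUnit (1 - (t / 2) • ⁅Γ, P⁆))
    (h' : IsUnit (1 + (t / 2) • ⁅Γ, P⁆)) :
    HasDerivAt (fun s : ℝ => retrGr P (s • Γ))
      ⁅((1 / 2 : ℝ) • ⁅Γ, P⁆) * ((1 - (t / 2) • ⁅Γ, P⁆)⁻¹ + (1 + (t / 2) • ⁅Γ, P⁆)⁻¹),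
        retrGr P (t • Γ)⁆ t := by
  have e : ∀ s : ℝ, (s / 2) • ⁅Γ, P⁆ = s • ((1 / 2 : ℝ) • ⁅Γ, P⁆) := fun s => by
    rw [smul_smul]; congr 1; ring
  have e' : ∀ s : ℝ, (1 / 2 : ℝ) • ⁅s • Γ, P⁆ = s • ((1 / 2 : ℝ) • ⁅Γ, P⁆) := fun s => by
    rw [Ring.lie_def, Ring.lie_def, smul_mul_assoc, mul_smul_comm, ← smul_sub, smul_comm]
  rw [e t] at *
  have := hasDerivAt_conj_cay_smul (hasDerivAt_const t P) h h'
  simp only [mul_zero, zero_mul, add_zero] at this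
  simp only [retrGr, e']
  exact this

theorem hasDerivAt_retrGr_smul_zero (P Γ : Mat n n) :
    HasDerivAt (fun s : ℝ => retrGr P (s • Γ)) ⁅⁅Γ, P⁆, P⁆ 0 := by
  have := hasDerivAt_retrGr_smul (P := P) (Γ := Γ) (t := 0) (by simp) (by simp)
  refine this.congr_deriv ?_
  simp only [zero_div, zero_smul, sub_zero, add_zero, inv_one, retrGr_zero]
  rw [mul_add, mul_one, ← add_smul]
  norm_num

end Grassmannian

/-! ### Differentials along lines and within subsets. -/

section Differential

variable {E F : Type*} [NormedAddCommGroup E] [NormedSpace ℝ E]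
  [NormedAddCommGroup F] [NormedSpace ℝ F]

theorem fderiv_apply_eq_of_hasDerivAt_line {f : E → F} {x v : E} {w : F}
    (hf : DifferentiableAt ℝ f x) (h : HasDerivAt (fun s : ℝ => f (x + s • v)) w 0) :
    fderiv ℝ f x v = w :=
  hf.lineDeriv_eq_fderiv.symm.trans h.deriv

/-- Needed because the differential of `retrGr P` at 0 on all matrices is v ↦ [[v,P],P], which is
the identity only on tangent vectors. The correction f' - g' vanishes on s. -/
theorem hasFDerivWithinAt_of_eqOn {f : E → F} {f' g' : E →L[ℝ] F} {s : Set E} {x : E}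
    (hf : HasFDerivWithinAt f f' s x) (hs : Set.EqOn f' g' s) (hx : f' x = g' x) :
    HasFDerivWithinAt f g' s x := by
  have h := hf.sub ((f' - g').hasFDerivWithinAt (s := s) (x := x))
  rw [sub_sub_cancel] at h
  refine h.congr (fun y hy => ?_) ?_
  · simp [hs hy]
  · simp [hx]

end Differential

/-! ### The symplectic Grassmannian is a smooth submanifold. -/

section Submanifold

variable {n k : ℕ}

/-- The equations of the tangent space of the symplectic Grassmann manifold at `P`. -/
def tangentSubmodule (P : Mat n n) : Submodule ℝ (Mat n n) where
  carrier := {Γ | sinv Γ = Γ ∧ Γ * P + P * Γ = Γ}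
  zero_mem' := by simp [sinv]
  add_mem' := by
    rintro A B ⟨hA, hA'⟩ ⟨hB, hB'⟩
    refine ⟨by rw [sinv_add, hA, hB], ?_⟩
    rw [add_mul, mul_add, add_add_add_comm, hA', hB']
  smul_mem' := by
    rintro c A ⟨hA, hA'⟩
    refine ⟨by rw [sinv_smul, hA], ?_⟩
    rw [smul_mul_assoc, mul_smul_comm, ← smul_add, hA']

/-- The projection of a matrix to the tangent space at `P`. -/
noncomputable def tangentProj (P X : Mat n n) : Mat n n := ⁅⁅(1 / 2 : ℝ) • (X + sinv X), P⁆, P⁆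

theorem tangentProj_smul (P X : Mat n n) (c : ℝ) :
    tangentProj P (c • X) = c • tangentProj P X := by
  simp only [tangentProj, sinv_smul, ← smul_add, smul_comm _ c, Ring.lie_def, smul_mul_assoc,
    mul_smul_comm, ← smul_sub]

theorem tangentProj_sub (P X Y : Mat n n) :
    tangentProj P (X - Y) = tangentProj P X - tangentProj P Y := by
  rw [tangentProj, sinv_sub, sub_add_sub_comm, smul_sub, tangentProj, tangentProj]
  simp only [Ring.lie_def, sub_mul, mul_sub]
  abel

theorem tangentProj_mem {P : Mat n n} (hP : P ∈ SpGr n k) (X : Mat n n) :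
    tangentProj P X ∈ tangentSubmodule P := by
  refine ⟨?_, lie_lie_idem hP.1⟩
  have h : sinv ((1 / 2 : ℝ) • (X + sinv X)) = (1 / 2 : ℝ) • (X + sinv X) := by
    rw [sinv_smul, sinv_add, sinv_sinv, add_comm]
  rw [tangentProj, sinv_lie, sinv_lie, h, hP.2.2]
  simp only [Ring.lie_def]
  noncomm_ring

theorem tangentProj_eq_self {P X : Mat n n} (hP : P ∈ SpGr n k) (hX : X ∈ tangentSubmodule P) :
    tangentProj P X = X := by
  rw [tangentProj, hX.1, ← two_smul ℝ X, smul_smul]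
  norm_num
  exact lie_lie_eq_self hP.1 hX.2

theorem contDiff_tangentProj (P : Mat n n) : ContDiff ℝ ∞ (tangentProj P) :=
  contDiff_iff_contDiffAt.2 fun _ =>
    contDiffAt_lie (contDiffAt_lie ((contDiffAt_id.add (contDiffAt_sinv contDiffAt_id)).const_smul _)
      contDiffAt_const) contDiffAt_const

/-- A projection near `P` whose difference to `P` is normal at `P` is `P` itself. -/
theorem eq_zero_of_add_mem_SpGr {P ν : Mat n n} (hP : P ∈ SpGr n k)
    (hν : ⁅⁅(1 / 2 : ℝ) • (ν + sinv ν), P⁆, P⁆ = 0) (hu : IsUnit (ν + (2 : ℝ) • P - 1))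
    (h : P + ν ∈ SpGr n k) : ν = 0 := by
  have hs : sinv ν = ν := by
    have := h.2.2
    rwa [sinv_add, hP.2.2, add_right_inj] at this
  rw [hs, ← two_smul ℝ ν, smul_smul, show (1 / 2 * 2 : ℝ) = 1 by norm_num, one_smul,
    lie_lie_eq hP.1] at hν
  have hPP := hP.1
  have h1 : P * ν = P * ν * P := by
    have := congrArg (P * ·) hν
    simp only [mul_add, mul_sub, ← mul_assoc, hPP, mul_zero, two_smul] at this
    rw [← sub_eq_zero, ← this]
    abel
  have h2 : ν * P = P * ν * P := by
    have h3 : ν * P - P * ν * P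
        = (ν * P - (2 : ℝ) • (P * ν * P) + P * ν) - (P * ν - P * ν * P) := by
      rw [two_smul]
      abel
    rw [hν, sub_eq_zero.2 h1, sub_zero] at h3
    exact sub_eq_zero.1 h3
  -- The off-diagonal blocks of ν vanish, so ν commutes with P and (P + ν)² = P + ν becomes this
  -- equation. For small ν the left factor is near the reflection 2P - 1, hence invertible.
  have h3 : (ν + (2 : ℝ) • P - 1) * ν = 0 := by
    have h4 := h.1
    rw [mul_add, add_mul, add_mul, hPP, h2.trans h1.symm] at h4
    have h5 : (ν + (2 : ℝ) • P - 1) * ν = P + P * ν + (P * ν + ν * ν) - (P + ν) := by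
      rw [two_smul]
      noncomm_ring
    rw [h5, h4, sub_self]
  exact (hu.mul_right_eq_zero).1 h3

theorem isSmoothSubmanifold_SpGr (n k : ℕ) : IsSmoothSubmanifold (SpGr n k) := by
  intro P hP
  have hPP := hP.1
  set X : Mat n n → Mat n n := fun A => (1 / 2 : ℝ) • ⁅tangentProj P A, P⁆ with hX
  set ψ : Mat n n → Mat n n := fun A => cay (X A) * (P + (A - tangentProj P A)) * cay (-X A) with hψ
  set O : Set (Mat n n) :=
    {A | IsUnit (1 - X A) ∧ IsUnit (A - tangentProj P A + (2 : ℝ) • P - 1)} with hO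
  have hτ := contDiff_tangentProj P
  have hXs : ContDiff ℝ ∞ X := contDiff_iff_contDiffAt.2 fun A =>
    (contDiffAt_lie hτ.contDiffAt contDiffAt_const).const_smul _
  have hskew : ∀ A, sinv (X A) = -X A := fun A => sinv_half_lie hP.2.2 (tangentProj_mem hP A).1
  have hν : ContDiff ℝ ∞ (fun A => A - tangentProj P A) := contDiff_id.sub hτ
  have hτ0 : tangentProj P 0 = 0 := by simpa using tangentProj_smul P 0 0
  have hX0 : X 0 = 0 := by simp [hX, hτ0, Ring.lie_def]
  have hψs : ∀ A ∈ O, ContDiffAt ℝ ∞ ψ A := fun A hA =>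
    contDiffAt_conj_cay hXs.contDiffAt (contDiffAt_const.add hν.contDiffAt) hA.1
      (isUnit_one_add (hskew A) hA.1)
  have h0O : (0 : Mat n n) ∈ O := by
    -- The reflection 2P - 1 is its own inverse.
    refine ⟨by simp [hX0], IsUnit.of_mul_eq_one ((2 : ℝ) • P - 1) ?_⟩
    rw [hτ0, sub_zero, zero_add, two_smul]
    simp only [sub_mul, mul_sub, add_mul, mul_add, hPP, mul_one, one_mul]
    abel
  refine exists_chart_of_local_parametrization (L := tangentSubmodule P) (ψ := ψ) (O := O)
    ?_ h0O (fun A hA => (hψs A hA).contDiffWithinAt) ?_ ?_ ?_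
  · exact (isOpen_setOf_isUnit_matrix.preimage (continuous_const.sub hXs.continuous)).inter
      (isOpen_setOf_isUnit_matrix.preimage ((hν.continuous.add continuous_const).sub
        continuous_const))
  · have hdiff := (hψs 0 h0O).differentiableAt (by simp)
    convert hdiff.hasFDerivAt using 1
    ext1 v
    refine (fderiv_apply_eq_of_hasDerivAt_line hdiff ?_).symm
    have hXv : ∀ s : ℝ, X (s • v) = s • X v := fun s => by
      simp only [hX, tangentProj_smul, Ring.lie_def, smul_mul_assoc, mul_smul_comm, ← smul_sub,
        smul_comm _ s]
    have hg : HasDerivAt (fun s : ℝ => P + (s • v - tangentProj P (s • v)))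
        (v - tangentProj P v) 0 := by
      have h0 := ((hasDerivAt_id (0 : ℝ)).smul_const (v - tangentProj P v)).const_add P
      rw [one_smul] at h0
      simp only [tangentProj_smul, ← smul_sub]
      exact h0
    have := hasDerivAt_conj_cay_smul (X := X v) hg (by simp) (by simp)
    simp only [zero_add, hψ, hXv]
    refine this.congr_deriv ?_
    simp only [zero_smul, sub_zero, add_zero, inv_one, hτ0, cay_zero, neg_zero, one_mul, mul_one]
    -- The two inverses at 0 sum to 2 and cancel the ½ in X. The commutator with P then returns the
    -- tangent part of v, and g' contributes the rest.
    have h2 : X v * (1 + 1) = ⁅tangentProj P v, P⁆ := by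
      simp only [hX]
      rw [mul_add, mul_one, ← add_smul]
      norm_num
    have hm := tangentProj_mem hP v
    rw [h2, lie_lie_eq_self hPP hm.2]
    exact add_sub_cancel _ _
  · simp [hψ, hX0, hτ0, cay_zero]
  · intro A hA
    refine (conj_cay_mem_SpGr_iff (hskew A) hA.1).trans ⟨fun h => ?_, fun h => ?_⟩
    · have hm := tangentProj_mem hP A
      have hz : tangentProj P (A - tangentProj P A) = 0 := by
        rw [tangentProj_sub, tangentProj_eq_self hP hm, sub_self]
      rw [sub_eq_zero.1 (eq_zero_of_add_mem_SpGr hP hz hA.2 h)]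
      exact hm
    · rw [tangentProj_eq_self hP h, sub_self, add_zero]
      exact hP

end Submanifold

/-! ### The retraction axioms. -/

section Retraction

variable {n k : ℕ}

theorem contDiffAt_retrGr {x : Mat n n × Mat n n} (h : IsUnit (1 - (1 / 2 : ℝ) • ⁅x.2, x.1⁆))
    (h' : IsUnit (1 + (1 / 2 : ℝ) • ⁅x.2, x.1⁆)) :
    ContDiffAt ℝ ∞ (fun x : Mat n n × Mat n n => retrGr x.1 x.2) x :=
  contDiffAt_conj_cay ((contDiffAt_lie contDiffAt_snd contDiffAt_fst).const_smul _) contDiffAt_fst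
    h h'

theorem continuous_half_lie (n : ℕ) :
    Continuous fun x : Mat n n × Mat n n => (1 / 2 : ℝ) • ⁅x.2, x.1⁆ := by
  have h : ContDiff ℝ ∞ fun x : Mat n n × Mat n n => (1 / 2 : ℝ) • ⁅x.2, x.1⁆ :=
    contDiff_iff_contDiffAt.2 fun x =>
      (contDiffAt_lie contDiffAt_snd contDiffAt_fst).const_smul _
  exact h.continuous

theorem zero_mem_tangentSpaceAt {E : Type*} [NormedAddCommGroup E] [NormedSpace ℝ E] {S : Set E}
    {p : E} (hp : p ∈ S) : (0 : E) ∈ tangentSpaceAt S p :=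
  ⟨1, fun _ => p, one_pos, contDiffOn_const, fun _ _ => hp, rfl, hasDerivAt_const _ _⟩

theorem isRetractionOn_retrGr (n k : ℕ) :
    IsRetractionOn (SpGr n k) (cayleyDomain n k) retrGr where
  submanifold := isSmoothSubmanifold_SpGr n k
  domain_open := by
    refine ⟨{x | IsUnit (1 - (1 / 2 : ℝ) • ⁅x.2, x.1⁆)}, ?_, rfl⟩
    exact isOpen_setOf_isUnit_matrix.preimage (continuous_const.sub (continuous_half_lie n))
  zero_mem p hp := ⟨⟨hp, zero_mem_tangentSpaceAt hp⟩, by simp [Ring.lie_def]⟩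
  maps_to x hx := retrGr_mem_SpGr hx.1.1 (sinv_eq_of_mem_tangentSpaceAt hx.1.2) hx.2
  smooth := by
    intro x hx
    have hc := continuous_half_lie n
    -- Off the tangent bundle the commutator need not be skew, so invertibility of 1 + X has to be
    -- imposed separately.
    refine ⟨{x | IsUnit (1 - (1 / 2 : ℝ) • ⁅x.2, x.1⁆) ∧ IsUnit (1 + (1 / 2 : ℝ) • ⁅x.2, x.1⁆)},
      fun x => retrGr x.1 x.2, ?_, ?_, ?_, fun _ _ => rfl⟩
    · exact (isOpen_setOf_isUnit_matrix.preimage (continuous_const.sub hc)).inter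
        (isOpen_setOf_isUnit_matrix.preimage (continuous_const.add hc))
    · exact ⟨hx.2, isUnit_one_add
        (sinv_half_lie hx.1.1.2.2 (sinv_eq_of_mem_tangentSpaceAt hx.1.2)) hx.2⟩
    · exact fun y hy => (contDiffAt_retrGr hy.1 hy.2).contDiffWithinAt
  map_zero p _ := retrGr_zero p
  differential_zero := by
    intro P hP
    have hs : ContDiffAt ℝ ∞ (retrGr P) 0 :=
      (contDiffAt_retrGr (x := (P, (0 : Mat n n))) (by simp [Ring.lie_def])
        (by simp [Ring.lie_def])).comp (0 : Mat n n) (contDiffAt_const.prodMk contDiffAt_id)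
    have hd := hs.differentiableAt (by simp)
    refine hasFDerivWithinAt_of_eqOn hd.hasFDerivAt.hasFDerivWithinAt (fun v hv => ?_) (by simp)
    refine fderiv_apply_eq_of_hasDerivAt_line hd ?_
    simp only [zero_add]
    refine (hasDerivAt_retrGr_smul_zero P v).congr_deriv ?_
    exact lie_lie_eq_self hP.1 (mul_add_mul_eq_of_mem_tangentSpaceAt hv.1.2)

end Retraction

/-! ### Horizontal lifts and the Stiefel retraction. -/

section Stiefel

variable {n k : ℕ}

theorem fderiv_rho (U Δ : Mat n k) : fderiv ℝ rho U Δ = Δ * sinv U + U * sinv Δ := by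
  have hd : DifferentiableAt ℝ (rho : Mat n k → Mat n n) U :=
    (contDiffAt_matrix_mul (r := 1) contDiffAt_id (contDiffAt_sinv contDiffAt_id)).differentiableAt
      one_ne_zero
  refine fderiv_apply_eq_of_hasDerivAt_line hd ?_
  have hl : HasDerivAt (fun s : ℝ => U + s • Δ) Δ 0 := by
    have h0 := ((hasDerivAt_id (0 : ℝ)).smul_const Δ).const_add U
    rw [one_smul] at h0
    exact h0
  have := hasDerivAt_matrix_mul hl (hasDerivAt_sinv hl)
  simp only [zero_smul, add_zero] at this
  exact this

theorem sinv_mul_add_of_mem_tangentSpaceAt_SpSt {U V : Mat n k}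
    (hV : V ∈ tangentSpaceAt (SpSt n k) U) : sinv V * U + sinv U * V = 0 := by
  obtain ⟨ε, γ, hε, -, hγ, h0, hd⟩ := hV
  have hev : ∀ᶠ t in nhds (0 : ℝ), sinv (γ t) * γ t = 1 := by
    filter_upwards [Ioo_mem_nhds (neg_lt_zero.2 hε) hε] with t ht
    exact hγ t ht
  rw [← h0]
  exact ((hasDerivAt_matrix_mul (hasDerivAt_sinv hd) hd).congr_of_eventuallyEq
    (Filter.EventuallyEq.symm hev)).unique (hasDerivAt_const _ _)

theorem cay_mul_mem_SpSt {X : Mat n n} {U : Mat n k} (hX : sinv X = -X) (h : IsUnit (1 - X))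
    (hU : U ∈ SpSt n k) : cay X * U ∈ SpSt n k := by
  have h2 := cay_neg_mul_cay h (isUnit_one_add hX h)
  change sinv (cay X * U) * (cay X * U) = 1
  rw [sinv_mul, sinv_cay hX h, Matrix.mul_assoc, ← Matrix.mul_assoc (cay (-X)), h2, Matrix.one_mul]
  exact hU

/-- The curve cay(sX/2)U stays in `SpSt`; the ½ offsets the factor 2 in the derivative of cay at 0.
-/
theorem mul_mem_tangentSpaceAt_SpSt {X : Mat n n} {U : Mat n k} (hX : sinv X = -X)
    (hU : U ∈ SpSt n k) : X * U ∈ tangentSpaceAt (SpSt n k) U := by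
  have ho : IsOpen {s : ℝ | IsUnit (1 - s • ((1 / 2 : ℝ) • X))} :=
    isOpen_setOf_isUnit_matrix.preimage
      (by fun_prop : Continuous fun s : ℝ => 1 - s • ((1 / 2 : ℝ) • X))
  obtain ⟨ε, hε, hball⟩ := Metric.isOpen_iff.1 ho 0 (by simp)
  rw [Real.ball_eq_Ioo, zero_sub, zero_add] at hball
  have hskew : ∀ s : ℝ, sinv (s • ((1 / 2 : ℝ) • X)) = -(s • ((1 / 2 : ℝ) • X)) := fun s => by
    rw [sinv_smul, sinv_smul, hX, smul_neg, smul_neg]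
  refine ⟨ε, fun s => cay (s • ((1 / 2 : ℝ) • X)) * U, hε, fun s hs => ?_, fun s hs => ?_, ?_, ?_⟩
  · exact (contDiffAt_matrix_mul (contDiffAt_cay (f := fun s : ℝ => s • ((1 / 2 : ℝ) • X))
      (contDiffAt_id.smul contDiffAt_const) (hball hs)) contDiffAt_const).contDiffWithinAt
  · exact cay_mul_mem_SpSt (hskew s) (hball hs) hU
  · simp [cay_zero]
  · refine (hasDerivAt_matrix_mul_const (hasDerivAt_cay_smul (by simp) (by simp)) U).congr_deriv ?_
    simp only [zero_smul, sub_zero, add_zero, inv_one, cay_zero, mul_one]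
    rw [mul_add, mul_one, ← add_smul]
    norm_num

theorem mul_skew_mem_verticalSt {U : Mat n k} {B : Mat k k} (hU : U ∈ SpSt n k)
    (hB : sinv B = -B) : U * B ∈ verticalSt U := by
  have hs : sinv (U * B * sinv U) = -(U * B * sinv U) := by
    rw [sinv_mul, sinv_mul, sinv_sinv, hB, Matrix.neg_mul, Matrix.mul_neg, Matrix.mul_assoc]
  refine ⟨?_, ?_⟩
  · have := mul_mem_tangentSpaceAt_SpSt hs hU
    rwa [Matrix.mul_assoc, show sinv U * U = 1 from hU, Matrix.mul_one] at this
  · rw [fderiv_rho, sinv_mul, hB, Matrix.neg_mul, Matrix.mul_neg, ← Matrix.mul_assoc, add_neg_cancel]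

/-- Multiplying VU⁺ + UV⁺ = 0 by U on the right gives V = -UV⁺U, and tangency replaces V⁺U by -U⁺V.
-/
theorem eq_mul_of_fderiv_rho_eq_zero {U V : Mat n k} (hU : U ∈ SpSt n k)
    (hT : sinv V * U + sinv U * V = 0) (hV : fderiv ℝ rho U V = 0) :
    V = U * (sinv U * V) ∧ sinv (sinv U * V) = -(sinv U * V) := by
  have h1 : V + U * (sinv V * U) = 0 := by
    have := congrArg (· * U) hV
    simpa only [fderiv_rho, Matrix.add_mul, Matrix.mul_assoc, show sinv U * U = 1 from hU,
      Matrix.mul_one, Matrix.zero_mul] using this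
  have h2 : sinv V * U = -(sinv U * V) := eq_neg_of_add_eq_zero_left hT
  refine ⟨?_, by rw [sinv_mul, sinv_sinv, h2]⟩
  rw [h2, Matrix.mul_neg, ← sub_eq_add_neg] at h1
  exact sub_eq_zero.1 h1

/-- Since U⁺U = 1, U⁺(1 - ½UU⁺) = ½U⁺. -/
theorem metricSt_mul {U : Mat n k} (hU : U ∈ SpSt n k) (B : Mat k k) (Δ : Mat n k) :
    metricSt U (U * B) Δ = 1 / 2 * (sinv B * (sinv U * Δ)).trace := by
  have h : sinv (U * B) * (1 - (1 / 2 : ℝ) • (U * sinv U)) = (1 / 2 : ℝ) • (sinv B * sinv U) := by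
    rw [sinv_mul, Matrix.mul_sub, Matrix.mul_one, Matrix.mul_smul, Matrix.mul_assoc (sinv B),
      ← Matrix.mul_assoc (sinv U), show sinv U * U = 1 from hU, Matrix.one_mul]
    module
  rw [metricSt, h, Matrix.smul_mul, Matrix.trace_smul, Matrix.mul_assoc, smul_eq_mul]

variable {Γ : Mat n n} {U : Mat n k}

theorem rho_mul_self (hU : U ∈ SpSt n k) : rho U * U = U := by
  rw [rho, Matrix.mul_assoc, show sinv U * U = 1 from hU, Matrix.mul_one]

theorem sinv_mul_rho (hU : U ∈ SpSt n k) : sinv U * rho U = sinv U := by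
  rw [rho, ← Matrix.mul_assoc, show sinv U * U = 1 from hU, Matrix.one_mul]

theorem sinv_mul_mul_eq_zero (hU : U ∈ SpSt n k) (hP : rho U * Γ * rho U = 0) :
    sinv U * (Γ * U) = 0 := by
  have h : sinv U * (rho U * Γ * rho U) * U = sinv U * (Γ * U) := by
    calc _ = (sinv U * rho U) * Γ * (rho U * U) := by simp only [Matrix.mul_assoc]
      _ = _ := by rw [sinv_mul_rho hU, rho_mul_self hU, Matrix.mul_assoc]
  rw [← h, hP]
  simp

theorem isHorizontalLift_mul (hU : U ∈ SpSt n k) (hs : sinv Γ = Γ) (hρ : rho U * rho U = rho U)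
    (hρs : sinv (rho U) = rho U) (hΓ : Γ * rho U + rho U * Γ = Γ) :
    IsHorizontalLift U Γ (Γ * U) := by
  have h0 := mul_mul_eq_zero_of_tangent hρ hΓ
  refine ⟨⟨?_, fun V hV => ?_⟩, ?_⟩
  · have hX : sinv ⁅Γ, rho U⁆ = -⁅Γ, rho U⁆ := by
      rw [sinv_lie, hs, hρs, Ring.lie_def, Ring.lie_def, neg_sub]
    have h := mul_mem_tangentSpaceAt_SpSt hX hU
    -- With P = UU⁺, PΓU = PΓPU = 0, so ΓU is the velocity of a symplectic motion of U.
    have e : ⁅Γ, rho U⁆ * U = Γ * U := by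
      calc ⁅Γ, rho U⁆ * U = Γ * (rho U * U) - rho U * Γ * (rho U * U) := by
            rw [rho_mul_self hU, Ring.lie_def, Matrix.sub_mul, Matrix.mul_assoc,
              rho_mul_self hU]
        _ = Γ * U := by
            rw [← Matrix.mul_assoc (rho U * Γ), h0, Matrix.zero_mul, sub_zero, rho_mul_self hU]
    rwa [e] at h
  · obtain ⟨hV1, -⟩ := eq_mul_of_fderiv_rho_eq_zero hU
      (sinv_mul_add_of_mem_tangentSpaceAt_SpSt hV.1) hV.2
    rw [hV1, metricSt_mul hU, sinv_mul_mul_eq_zero hU h0]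
    simp
  · rw [fderiv_rho, sinv_mul, hs, Matrix.mul_assoc, ← Matrix.mul_assoc U]
    exact hΓ

theorem isHorizontalLift_iff (hU : U ∈ SpSt n k) (hs : sinv Γ = Γ) (hρ : rho U * rho U = rho U)
    (hρs : sinv (rho U) = rho U) (hΓ : Γ * rho U + rho U * Γ = Γ) (Δ : Mat n k) :
    IsHorizontalLift U Γ Δ ↔ Δ = Γ * U := by
  have hl := isHorizontalLift_mul hU hs hρ hρs hΓ
  refine ⟨fun h => ?_, fun h => h ▸ hl⟩
  have hT : sinv (Δ - Γ * U) * U + sinv U * (Δ - Γ * U) = 0 := by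
    have h1 := sinv_mul_add_of_mem_tangentSpaceAt_SpSt h.1.1
    have h2 := sinv_mul_add_of_mem_tangentSpaceAt_SpSt hl.1.1
    rw [sinv_sub, Matrix.sub_mul, Matrix.mul_sub, sub_add_sub_comm, h1, h2, sub_zero]
  obtain ⟨hW, hA⟩ := eq_mul_of_fderiv_rho_eq_zero hU hT (by rw [map_sub, h.2, hl.2, sub_self])
  have h0 := sinv_mul_mul_eq_zero hU (mul_mul_eq_zero_of_tangent hρ hΓ)
  set A := sinv U * (Δ - Γ * U) with hAdef
  have hAΔ : sinv U * Δ = A := by rw [hAdef, Matrix.mul_sub, h0, sub_zero]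
  -- The metric is indefinite, so the vertical difference UA is tested against UAᵀ rather than
  -- itself: this gives tr(AᵀA) = 0, which forces A = 0.
  have hAt : sinv A.transpose = -A.transpose := by rw [sinv_transpose, hA, Matrix.transpose_neg]
  have h1 := h.1.2 _ (mul_skew_mem_verticalSt hU hAt)
  rw [metricSt_mul hU, hAΔ, hAt, Matrix.neg_mul, Matrix.trace_neg] at h1
  have h2 : (A.conjTranspose * A).trace = 0 := by
    rw [Matrix.conjTranspose_eq_transpose_of_trivial]
    linarith
  rw [Matrix.trace_conjTranspose_mul_self_eq_zero_iff] at h2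
  rw [h2, Matrix.mul_zero] at hW
  exact sub_eq_zero.1 hW

/-- Both terms with the factor ½ contain PΓP = 0. -/
theorem tildeOmega_mul (hs : sinv Γ = Γ) (hρ : rho U * rho U = rho U)
    (hΓ : Γ * rho U + rho U * Γ = Γ) : tildeOmega U (Γ * U) = ⁅Γ, rho U⁆ := by
  have h0 := mul_mul_eq_zero_of_tangent hρ hΓ
  have e : tildeOmega U (Γ * U) = (1 - (1 / 2 : ℝ) • rho U) * (Γ * rho U) -
      (rho U * Γ) * (1 - (1 / 2 : ℝ) • rho U) := by
    simp only [tildeOmega, rho, sinv_mul, hs, Matrix.mul_assoc]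
  rw [e, sub_mul, mul_sub, one_mul, mul_one, smul_mul_assoc, mul_smul_comm, ← mul_assoc, h0,
    Ring.lie_def]
  simp

theorem rho_retrSt {Δ : Mat n k}
    (hX : sinv ((1 / 2 : ℝ) • ⁅Γ, rho U⁆) = -((1 / 2 : ℝ) • ⁅Γ, rho U⁆))
    (h : IsUnit (1 - (1 / 2 : ℝ) • ⁅Γ, rho U⁆)) (hΩ : tildeOmega U Δ = ⁅Γ, rho U⁆) :
    rho (retrSt U Δ) = retrGr (rho U) Γ := by
  rw [retrSt, hΩ, rho, sinv_mul, sinv_cay hX h, retrGr]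
  simp only [rho, Matrix.mul_assoc]

end Stiefel

end SymplecticGrassmann

theorem mainTheorem10 (n k : ℕ) :
    IsRetractionOn (SpGr n k) (cayleyDomain n k) retrGr ∧
    ∀ P ∈ SpGr n k, ∀ Γ ∈ tangentSpaceAt (SpGr n k) P,
      (∀ U ∈ SpSt n k, rho U = P →
        (∀ Δ : Mat n k, IsHorizontalLift U Γ Δ ↔ Δ = Γ * U) ∧
        (∀ Δ : Mat n k, IsHorizontalLift U Γ Δ → IsUnit (1 - (1 / 2 : ℝ) • ⁅Γ, P⁆) →
          IsUnit (1 - (1 / 2 : ℝ) • tildeOmega U Δ) ∧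
          retrSt U Δ ∈ SpSt n k ∧ retrGr P Γ = rho (retrSt U Δ))) ∧
      (∀ t : ℝ, IsUnit (1 - (t / 2) • ⁅Γ, P⁆) →
        IsUnit (1 + (t / 2) • ⁅Γ, P⁆) ∧
        HasDerivAt (fun s : ℝ => retrGr P (s • Γ))
          ⁅((1 / 2 : ℝ) • ⁅Γ, P⁆) * ((1 - (t / 2) • ⁅Γ, P⁆)⁻¹ + (1 + (t / 2) • ⁅Γ, P⁆)⁻¹),
            retrGr P (t • Γ)⁆ t) ∧
      HasDerivAt (fun s : ℝ => retrGr P (s • Γ)) ⁅⁅Γ, P⁆, P⁆ 0 ∧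
      ⁅⁅Γ, P⁆, P⁆ = Γ := by
  refine ⟨isRetractionOn_retrGr n k, fun P hP Γ hΓ => ?_⟩
  have hs := sinv_eq_of_mem_tangentSpaceAt hΓ
  have hT := mul_add_mul_eq_of_mem_tangentSpaceAt hΓ
  refine ⟨?_, fun t ht => ?_, hasDerivAt_retrGr_smul_zero P Γ, lie_lie_eq_self hP.1 hT⟩
  · rintro U hU rfl
    have hiff := isHorizontalLift_iff hU hs hP.1 hP.2.2 hT
    refine ⟨hiff, fun Δ hΔ h => ?_⟩
    have hΩ : tildeOmega U Δ = ⁅Γ, rho U⁆ := by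
      rw [(hiff Δ).1 hΔ, tildeOmega_mul hs hP.1 hT]
    have hX := sinv_half_lie hP.2.2 hs
    refine ⟨by rwa [hΩ], ?_, (rho_retrSt hX h hΩ).symm⟩
    rw [retrSt, hΩ]
    exact cay_mul_mem_SpSt hX h hU
  · have h' : IsUnit (1 + (t / 2) • ⁅Γ, P⁆) := by
      refine isUnit_one_add ?_ ht
      rw [sinv_smul, sinv_lie, hP.2.2, hs, ← smul_neg, Ring.lie_def, Ring.lie_def, neg_sub]
    exact ⟨h', hasDerivAt_retrGr_smul ht h'⟩
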